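/- Let $d\ge 1$, $t\in\mathbb R\setminus\{0\}$ and $h_0>0$. For an even integer $L\ge 2$ let $\Lambda_L=(\mathbb Z/L\mathbb Z)^d$, let $c_{x\sigma}^{*},c_{x\sigma}$ ($x\in\Lambda_L$, $\sigma\in\{\uparrow,\downarrow\}$) be the creation and annihilation operators on the fermionic Fock space over $\ell^2(\Lambda_L)\otimes\mathbb C^2$, and put $$n_{x\sigma}=c_{x\sigma}^{*}c_{x\sigma},\qquad n_x=n_{x\uparrow}+n_{x\downarrow},\qquad \eta_x=(-1)^{x_1+\cdots+x_d}.$$ For $U>0$ and $h\in\mathbb R$ let $$H_{\Lambda_L}(h)=U\sum_{x}n_{x\uparrow}n_{x\downarrow}-t\sum_{\{x,y\}}\sum_{\sigma}\bigl(c_{x\sigma}^{*}c_{y\sigma}+c_{y\sigma}^{*}c_{x\sigma}\bigr)-h\sum_x \eta_x\,\tfrac12\,(n_{x\uparrow}-n_{x\downarrow}),$$ where $\{x,y\}$ runs over the unordered nearest-neighbour bonds of the torus $\Lambda_L$, each counted once. Let $\mathcal H^{\rm hf}_{\Lambda_L}=\ker\bigl(\sum_x n_x-|\Lambda_L|\bigr)$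 be the half-filled sector, and for $\beta>0$ let $$\omega_{\Lambda_L,\beta,U,h}(O)=\frac{\operatorname{Tr}_{\mathcal H^{\rm hf}_{\Lambda_L}}\bigl(O\,e^{-\beta H_{\Lambda_L}(h)}\bigr)}{\operatorname{Tr}_{\mathcal H^{\rm hf}_{\Lambda_L}}\,e^{-\beta H_{\Lambda_L}(h)}}$$ be the canonical half-filled Gibbs state. Put $J_0(U)=4t^2/U$, $q_x=(n_x-1)^2$ and $C^{\rm ch}_{\Lambda_L}=\sum_{x\in\Lambda_L}\eta_x(n_x-1)$. **Theorem (charge-sector suppression and absence of macroscopic CDW).** There is an error function $\varepsilon_{\rm ch}(U,\beta;h_0)\ge 0$ (depending also on $d$ and $t$) such that for every $\ell_0>0$ the following holds. There is $U_0=U_0(\ell_0,d,h_0,t)>0$ such that for all $U\ge U_0$, all $\beta>0$ with $\beta J_0(U)\ge \ell_0$, all even $L\ge 2$ and all $|h|\le h_0$, writing $\omega=\omega_{\Lambda_L,\beta,U,h}$, $$\frac1{|\Lambda_L|}\sum_{x\in\Lambda_L}\omega(q_x)\le \varepsilon_{\rm ch}(U,\beta;h_0),\qquad \frac1{|\Lambda_L|}\sum_{x\in\Lambda_L}\omega(n_{x\uparrow}n_{x\downarrow})\le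 \tfrac12\,\varepsilon_{\rm ch}(U,\beta;h_0),$$ $$\Bigl|\frac1{|\Lambda_L|}\,\omega(C^{\rm ch}_{\Lambda_L})\Bigr|\le \varepsilon_{\rm ch}(U,\beta;h_0),\qquad \frac1{|\Lambda_L|^2}\,\omega\bigl((C^{\rm ch}_{\Lambda_L})^2\bigr)\le \varepsilon_{\rm ch}(U,\beta;h_0).$$ Moreover, $$\lim_{U\to\infty}\ \sup_{\beta>0,\ \beta J_0(U)\ge \ell_0}\varepsilon_{\rm ch}(U,\beta;h_0)=0.$$ -/

import Mathlib

open scoped ComplexOrder ENNReal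

noncomputable section

namespace Hubbard

/-! ### Fermionic Fock space over a finite set of modes

For a finite set `ι` of modes, the Fock space `⨁ₙ ⋀ⁿ ℂ^ι` has the orthonormal occupation-number
basis `e_S = e_{i₁} ∧ ⋯ ∧ e_{iₖ}`, where `S = {i₁ < ⋯ < iₖ}` runs over the finite subsets of `ι`
and the modes are listed in a fixed order.  Operators on the Fock space are written as
matrices in this basis. -/

section Fock

variable {ι : Type*} [Fintype ι] [DecidableEq ι]

/-- Operators on the Fock space `⨁ₙ ⋀ⁿ ℂ^ι`, in the occupation-number basis. -/
abbrev FockOp (ι : Type*) : Type _ := Matrix (Finset ι) (Finset ι) ℂ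

/-- The sign `(-1)^{#{j ∈ S : j < i}}` with `e_i ∧ e_S = ± e_{S ∪ {i}}` for `i ∉ S`,
with respect to a fixed enumeration of the modes. -/
def wedgeSign (i : ι) (S : Finset ι) : ℂ :=
  (-1) ^ (S.filter fun j => Fintype.equivFin ι j < Fintype.equivFin ι i).card

/-- The creation operator `c_i^*`, i.e. `ψ ↦ e_i ∧ ψ`. -/
def create (i : ι) : FockOp ι :=
  Matrix.of fun S' S => if i ∉ S ∧ S' = insert i S then wedgeSign i S else 0

/-- The annihilation operator `c_i`, the adjoint of `c_i^*`. -/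
def annihilate (i : ι) : FockOp ι := (create i).conjTranspose

/-- The occupation number operator `n_i = c_i^* c_i` of the mode `i`. -/
def modeNumber (i : ι) : FockOp ι := create i * annihilate i

theorem create_apply (i : ι) (S' S : Finset ι) :
    create i S' S = if i ∉ S ∧ S' = insert i S then wedgeSign i S else 0 := rfl

theorem annihilate_apply (i : ι) (S' S : Finset ι) :
    annihilate i S' S = if i ∉ S' ∧ S = insert i S' then wedgeSign i S' else 0 := by
  simp only [annihilate, Matrix.conjTranspose_apply, create_apply, apply_ite (star : ℂ → ℂ)]
  simp [wedgeSign]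

theorem wedgeSign_mul_self (i : ι) (S : Finset ι) : wedgeSign i S * wedgeSign i S = 1 := by
  simp [wedgeSign, ← mul_pow]

theorem wedgeSign_insert (i j : ι) (S : Finset ι) (hj : j ∉ S) :
    wedgeSign i (insert j S) =
      (if Fintype.equivFin ι j < Fintype.equivFin ι i then -1 else 1) * wedgeSign i S := by
  unfold wedgeSign
  rw [Finset.filter_insert]
  split_ifs
  · rw [Finset.card_insert_of_notMem (by simp [hj]), pow_succ]; ring
  · simp

theorem wedgeSign_swap (i j : ι) (h : i ≠ j) (S : Finset ι) (hi : i ∉ S) (hj : j ∉ S) :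
    wedgeSign i (insert j S) * wedgeSign j S = -(wedgeSign j (insert i S) * wedgeSign i S) := by
  rw [wedgeSign_insert i j S hj, wedgeSign_insert j i S hi]
  have : Fintype.equivFin ι i ≠ Fintype.equivFin ι j := by simpa using h
  rcases lt_or_gt_of_ne this with h' | h'
  · simp [h', not_lt.mpr h'.le]; ring
  · simp [h', not_lt.mpr h'.le]; ring

/-- The operators satisfy `{c_i^*, c_j^*} = 0`. -/
theorem create_anticomm (i j : ι) : create i * create j + create j * create i = 0 := by
  have key (i j : ι) (A B : Finset ι) : (create i * create j) A B =
      if j ∉ B ∧ i ∉ insert j B ∧ A = insert i (insert j B) then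
        wedgeSign i (insert j B) * wedgeSign j B else 0 := by
    rw [Matrix.mul_apply, Finset.sum_eq_single (insert j B)]
    · simp only [create_apply]; split_ifs <;> simp_all
    · intro C _ hC; simp [create_apply j, hC]
    · simp
  ext A B
  rw [Matrix.add_apply, key, key, Finset.insert_comm j i]
  by_cases h : i = j
  · subst h; simp
  by_cases hi : i ∈ B
  · simp [hi]
  by_cases hj : j ∈ B
  · simp [hj]
  have := wedgeSign_swap i j h B hi hj
  by_cases hA : A = insert i (insert j B)
  · simp [hi, hj, h, Ne.symm h, hA, this]
  · simp [hA]

/-- The operators satisfy `{c_i, c_j^*} = δ_{ij}`. -/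
theorem annihilate_create_anticomm (i j : ι) :
    annihilate i * create j + create j * annihilate i = if i = j then 1 else 0 := by
  have k1 (A B : Finset ι) : (annihilate i * create j) A B =
      if j ∉ B ∧ i ∉ A ∧ insert i A = insert j B then wedgeSign i A * wedgeSign j B else 0 := by
    rw [Matrix.mul_apply, Finset.sum_eq_single (insert j B)]
    · simp only [create_apply, annihilate_apply]; split_ifs <;> simp_all
    · intro C _ hC; simp [create_apply, hC]
    · simp
  have k2 (A B : Finset ι) : (create j * annihilate i) A B =
      if i ∈ B ∧ j ∉ B.erase i ∧ A = insert j (B.erase i) then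
        wedgeSign j (B.erase i) * wedgeSign i (B.erase i) else 0 := by
    rw [Matrix.mul_apply, Finset.sum_eq_single (B.erase i)]
    · simp only [create_apply, annihilate_apply]
      by_cases hi : i ∈ B
      · simp only [hi, Finset.insert_erase]; split_ifs <;> simp_all
      · have hn : ¬(i ∉ B.erase i ∧ B = insert i (B.erase i)) := fun hh =>
          hi (by rw [hh.2]; exact Finset.mem_insert_self _ _)
        rw [if_neg hn]
        simp [hi]
    · intro C _ hC
      rw [annihilate_apply, if_neg, mul_zero]
      rintro ⟨h1, rfl⟩; simp [h1] at hC
    · simp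
  ext A B
  rw [Matrix.add_apply, k1, k2]
  clear k1 k2
  by_cases h : i = j
  · subst h
    by_cases hA : A = B
    · subst hA
      by_cases hi : i ∈ A <;> simp [hi, wedgeSign_mul_self]
    · have h1 : ¬(i ∉ B ∧ i ∉ A ∧ insert i A = insert i B) := by
        rintro ⟨hB, hA', he⟩
        exact hA (by rw [← Finset.erase_insert hA', he, Finset.erase_insert hB])
      have h2 : ¬(i ∈ B ∧ i ∉ B.erase i ∧ A = insert i (B.erase i)) := by
        rintro ⟨hB, -, he⟩
        exact hA (by rw [he, Finset.insert_erase hB])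
      rw [if_neg h1, if_neg h2]
      simp [hA]
  · simp only [h, if_false, Matrix.zero_apply]
    by_cases hi : i ∈ B
    · by_cases hj : j ∈ B
      · simp [hj, Ne.symm h]
      · obtain ⟨C, hC, rfl⟩ : ∃ C, i ∉ C ∧ B = insert i C :=
          ⟨B.erase i, by simp, by simp [hi]⟩
        have hjC : j ∉ C := fun hc => hj (Finset.mem_insert_of_mem hc)
        by_cases hA : A = insert j C
        · subst hA
          have h1 := wedgeSign_insert i j C hjC
          have h2 := wedgeSign_insert j i C hC
          have h3 := wedgeSign_swap i j h C hC hjC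
          have e1 := wedgeSign_mul_self i C
          have e2 := wedgeSign_mul_self j C
          have hne : Fintype.equivFin ι i ≠ Fintype.equivFin ι j := by simpa using h
          rw [if_pos ⟨hj, by simp [h, hC], Finset.insert_comm i j C⟩,
            if_pos ⟨hi, by simp [hC, hjC], by simp [hC]⟩, Finset.erase_insert hC, h1, h2]
          rcases lt_or_gt_of_ne hne with h' | h'
          · simp [h', not_lt.mpr h'.le]; ring
          · simp [h', not_lt.mpr h'.le]; ring
        · rw [if_neg, if_neg, add_zero]
          · rintro ⟨-, -, he⟩
            exact hA (by rw [he, Finset.erase_insert hC])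
          · rintro ⟨-, hiA, he⟩
            exact hA (by rw [← Finset.erase_insert hiA, he, Finset.insert_comm j i,
              Finset.erase_insert (by simp [h, hC])])
    · rw [if_neg, if_neg, add_zero]
      · exact fun hh => hi hh.1
      · rintro ⟨-, -, he⟩
        have : i ∈ insert j B := he ▸ Finset.mem_insert_self i A
        simp [h, hi] at this

end Fock

/-! ### The torus -/

/-- The discrete torus `Λ_L = (ℤ/Lℤ)^d`. -/
abbrev Torus (d L : ℕ) : Type := Fin d → ZMod L

/-- The nearest-neighbour graph of the torus; its edges are the unordered nearest-neighbour
bonds, each counted once. -/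
def bondGraph (d L : ℕ) : SimpleGraph (Torus d L) :=
  SimpleGraph.fromRel fun x y => ∃ i : Fin d, y = x + Pi.single i 1

/-- The electron modes `(x, σ)`, with `σ = 0` for spin up and `σ = 1` for spin down. -/
abbrev Mode (d L : ℕ) : Type := Torus d L × Fin 2

/-- The staggering `η_x = (-1)^{x_1 + ⋯ + x_d}` (for even `L`, independent of representatives). -/
def stagger {d L : ℕ} (x : Torus d L) : ℂ := (-1) ^ (∑ i, (x i).val)

section Operators

variable {d L : ℕ} [NeZero L]

/-- `n_{x↑}`. -/
def nUp (x : Torus d L) : FockOp (Mode d L) := modeNumber (x, 0)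

/-- `n_{x↓}`. -/
def nDown (x : Torus d L) : FockOp (Mode d L) := modeNumber (x, 1)

/-- The site occupation number `n_x = n_{x↑} + n_{x↓}`. -/
def siteNumber (x : Torus d L) : FockOp (Mode d L) := nUp x + nDown x

/-- The spin operator `S_x^{(3)} = (n_{x↑} - n_{x↓}) / 2`. -/
def spinZ (x : Torus d L) : FockOp (Mode d L) := (1 / 2 : ℂ) • (nUp x - nDown x)

/-- The charge defect observable `q_x = (n_x - 1)^2`. -/
def defect (x : Torus d L) : FockOp (Mode d L) := (siteNumber x - 1) ^ 2

/-- `∑_σ (c_{xσ}^* c_{yσ} + c_{yσ}^* c_{xσ})`. -/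
def bondHop (x y : Torus d L) : FockOp (Mode d L) :=
  ∑ σ : Fin 2, (create (x, σ) * annihilate (y, σ) + create (y, σ) * annihilate (x, σ))

theorem bondHop_comm (x y : Torus d L) : bondHop x y = bondHop y x :=
  Finset.sum_congr rfl fun _ _ => add_comm _ _

variable (d L)

/-- The staggered charge `C^ch = ∑_x η_x (n_x - 1)`. -/
def staggeredCharge : FockOp (Mode d L) := ∑ x : Torus d L, stagger x • (siteNumber x - 1)

/-- The staggered magnetisation `M = ∑_x η_x S_x^{(3)}`. -/
def staggeredMagnetisation : FockOp (Mode d L) := ∑ x : Torus d L, stagger x • spinZ x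

/-- The number of doubly occupied sites `D = ∑_x n_{x↑} n_{x↓}`. -/
def doubleOccupancy : FockOp (Mode d L) := ∑ x : Torus d L, nUp x * nDown x

open Classical in
/-- The hopping term `T = -t ∑_{ {x,y} } ∑_σ (c_{xσ}^* c_{yσ} + c_{yσ}^* c_{xσ})`, summed over
unordered nearest-neighbour bonds. -/
def hopping (t : ℝ) : FockOp (Mode d L) :=
  -(t : ℂ) • ∑ b ∈ (bondGraph d L).edgeFinset, Sym2.lift ⟨bondHop, bondHop_comm⟩ b

/-- The Hubbard Hamiltonian with staggered field, `H(h) = U D + T - h M`, on the Fock space. -/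
def hamiltonian (t U h : ℝ) : FockOp (Mode d L) :=
  (U : ℂ) • doubleOccupancy d L + hopping d L t - (h : ℂ) • staggeredMagnetisation d L

/-- The occupation-number basis of the half-filled sector `ker (N - |Λ|) = ⋀^{|Λ|} ℂ^{modes}`. -/
abbrev HalfFilled : Type :=
  {S : Finset (Mode d L) // S.card = Fintype.card (Torus d L)}

variable {d L}

/-- The restriction of a particle-number preserving operator to the half-filled sector. -/
def toHalfFilled (A : FockOp (Mode d L)) : Matrix (HalfFilled d L) (HalfFilled d L) ℂ :=
  A.submatrix Subtype.val Subtype.val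

variable (d L)

/-- The Boltzmann operator `e^{-β H(h)}` on the half-filled sector. -/
def boltzmann (t U β h : ℝ) : Matrix (HalfFilled d L) (HalfFilled d L) ℂ :=
  NormedSpace.exp (-(β : ℂ) • toHalfFilled (hamiltonian d L t U h))

/-- The Hubbard partition function `Z = Tr e^{-β H(h)}` of the half-filled sector. -/
def partitionFunction (t U β h : ℝ) : ℂ := (boltzmann d L t U β h).trace

/-- The canonical half-filled Hubbard Gibbs state `ω(O) = Tr (O e^{-β H(h)}) / Z`, evaluated at
the restriction to the half-filled sector of a particle-number preserving operator `O`. -/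
def gibbs (t U β h : ℝ) (O : FockOp (Mode d L)) : ℂ :=
  (toHalfFilled O * boltzmann d L t U β h).trace / partitionFunction d L t U β h

end Operators

/-- The superexchange coupling `J₀(U) = 4 t² / U`. -/
def exchange (t U : ℝ) : ℝ := 4 * t ^ 2 / U

end Hubbard

end

/-!
The energy cost `U` of a doubly occupied site is compared with the rest of the free energy, which
is extensive with a density bounded uniformly in `U`.

Write `H(h) = U D + K` with `K = T - h M`. Each bond term satisfies
`±(c_i^* c_j + c_j^* c_i) ≤ n_i + n_j ≤ 2`, because `(c_i ± c_j)^* (c_i ± c_j) ≥ 0`, and the torus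
has at most `d |Λ|` bonds; the field term is diagonal. Hence `-k |Λ| ≤ K ≤ k |Λ|` with
`k = 4 |t| d + h₀` (`posSemidef_smul_free_add`). The Gibbs variational principle
(`re_trace_mul_exp_neg_le`), with the fully polarized configuration as trial state, bounds `ω(H)`
from above: that configuration has no doubly occupied site, and the entropy of the half-filled
sector is at most of order `|Λ|`, so `ω(H) ≤ k |Λ| + 3 |Λ| / β`. Since `H ≥ U D - k |Λ|`, this gives
`ω(D) ≤ |Λ| (2 k + 3 / β) / U` (`sum_doubleOcc_mul_gibbsWeight_le`).

All charge observables are diagonal in the occupation-number basis, in which `ω` is a probability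
measure (`gibbs_diagonal`). At half filling the numbers of empty and of doubly occupied sites
agree, so `∑ q_x = 2 D`; moreover `|C^ch| ≤ ∑ q_x`, and `(C^ch)^2 ≤ |Λ| ∑ q_x` by Cauchy-Schwarz.
All four estimates follow with the error `2 (2 k + 3 / β) / U`. It does not depend on `ℓ₀`; the
condition `β J₀(U) ≥ ℓ₀` means `1 / β ≤ 4 t² / (ℓ₀ U)`, which gives the limit `U → ∞`.
-/

noncomputable section

namespace Hubbard

/-! ### Matrix exponentials and the variational principle -/

section Spectral

open Matrix

variable {n : Type*} [Fintype n] [DecidableEq n]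

theorem exists_diagonalization_exp_neg {A : Matrix n n ℂ} (hA : A.IsHermitian) :
    ∃ (V : Matrix n n ℂ) (l : n → ℝ), Vᴴ * V = 1 ∧ V * Vᴴ = 1 ∧
      A = V * diagonal (fun i => (l i : ℂ)) * Vᴴ ∧
      NormedSpace.exp (-A) = V * diagonal (fun i => (Real.exp (-l i) : ℂ)) * Vᴴ := by
  have h1 : (hA.eigenvectorUnitary : Matrix n n ℂ)ᴴ * hA.eigenvectorUnitary = 1 :=
    Unitary.coe_star_mul_self _
  have h2 : (hA.eigenvectorUnitary : Matrix n n ℂ) * (hA.eigenvectorUnitary : Matrix n n ℂ)ᴴ = 1 :=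
    Unitary.coe_mul_star_self _
  have h3 : A = (hA.eigenvectorUnitary : Matrix n n ℂ) *
      diagonal (fun i => (hA.eigenvalues i : ℂ)) * (hA.eigenvectorUnitary : Matrix n n ℂ)ᴴ := by
    have := hA.spectral_theorem
    rwa [Unitary.conjStarAlgAut_apply] at this
  refine ⟨hA.eigenvectorUnitary, hA.eigenvalues, h1, h2, h3, ?_⟩
  have hinv : (hA.eigenvectorUnitary : Matrix n n ℂ)⁻¹ = (hA.eigenvectorUnitary : Matrix n n ℂ)ᴴ :=
    inv_eq_right_inv h2
  have h4 : -A = (hA.eigenvectorUnitary : Matrix n n ℂ) *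
      diagonal (fun i => -(hA.eigenvalues i : ℂ)) * (hA.eigenvectorUnitary : Matrix n n ℂ)⁻¹ := by
    have h5 : diagonal (fun i => -(hA.eigenvalues i : ℂ)) =
        -diagonal (fun i => (hA.eigenvalues i : ℂ)) := by
      rw [diagonal_neg]
    rw [hinv, h5, mul_neg, neg_mul, ← h3]
  rw [h4, exp_conj _ _ (IsUnit.of_mul_eq_one _ h2), exp_diagonal, hinv]
  congr 3
  funext i
  simp [Pi.coe_exp, Complex.exp_eq_exp_ℂ]

theorem posDef_exp_neg {A : Matrix n n ℂ} (hA : A.IsHermitian) :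
    (NormedSpace.exp (-A)).PosDef := by
  obtain ⟨V, l, h1, h2, -, hE⟩ := exists_diagonalization_exp_neg hA
  rw [hE]
  refine (PosDef.diagonal fun i => ?_).mul_mul_conjTranspose_same ?_
  · exact_mod_cast Real.exp_pos _
  · exact Function.LeftInverse.injective (g := fun v => v ᵥ* Vᴴ) fun v => by
      simp [vecMul_vecMul, h2]

open scoped MatrixOrder in
theorem trace_mul_nonneg {A B : Matrix n n ℂ} (hA : A.PosSemidef) (hB : B.PosSemidef) :
    0 ≤ (A * B).trace := by
  obtain ⟨C, rfl⟩ := CStarAlgebra.nonneg_iff_eq_star_mul_self.mp hB.nonneg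
  rw [← mul_assoc, trace_mul_comm, ← mul_assoc]
  exact (hA.mul_mul_conjTranspose_same C).trace_nonneg

/-- The Gibbs variational principle with a basis vector as trial state, and the entropy bounded
by `c + 1`, where `c` is at least the logarithm of the dimension. -/
theorem re_trace_mul_exp_neg_le {A : Matrix n n ℂ} (hA : A.IsHermitian) (s : n) (c : ℝ)
    (hc : (Fintype.card n : ℝ) ≤ Real.exp c) :
    (A * NormedSpace.exp (-A)).trace.re ≤
      ((A s s).re + c + 1) * (NormedSpace.exp (-A)).trace.re := by
  obtain ⟨V, l, h1, h2, hV, hE⟩ := exists_diagonalization_exp_neg hA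
  set a := (A s s).re with ha
  have tr (D : n → ℂ) : (V * diagonal D * Vᴴ).trace = ∑ i, D i := by
    rw [trace_mul_comm, ← mul_assoc, h1, one_mul, trace_diagonal]
  have hZ : (NormedSpace.exp (-A)).trace.re = ∑ i, Real.exp (-l i) := by
    rw [hE, tr, Complex.re_sum]
    simp only [Complex.ofReal_re]
  have hAE : (A * NormedSpace.exp (-A)).trace.re = ∑ i, l i * Real.exp (-l i) := by
    have : A * NormedSpace.exp (-A) =
        V * diagonal (fun i => (l i : ℂ) * (Real.exp (-l i) : ℂ)) * Vᴴ := by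
      rw [hE]
      nth_rw 1 [hV]
      rw [← diagonal_mul_diagonal]
      calc V * diagonal (fun i => (l i : ℂ)) * Vᴴ *
            (V * diagonal (fun i => (Real.exp (-l i) : ℂ)) * Vᴴ)
          = V * diagonal (fun i => (l i : ℂ)) * (Vᴴ * V) *
            diagonal (fun i => (Real.exp (-l i) : ℂ)) * Vᴴ := by simp only [mul_assoc]
        _ = _ := by rw [h1, mul_one]; simp only [mul_assoc]
    rw [this, tr, Complex.re_sum]
    simp only [← Complex.ofReal_mul, Complex.ofReal_re]
  -- The lowest eigenvalue lies below the diagonal entry `a`, a convex combination of eigenvalues.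
  obtain ⟨i₀, -, hi₀⟩ := Finset.exists_min_image Finset.univ l ⟨s, Finset.mem_univ s⟩
  have hentry (D : n → ℝ) : ((V * diagonal (fun i => (D i : ℂ)) * Vᴴ) s s).re =
      ∑ i, Complex.normSq (V s i) * D i := by
    rw [mul_apply, Complex.re_sum]
    refine Finset.sum_congr rfl fun i _ => ?_
    rw [mul_diagonal, conjTranspose_apply, mul_right_comm, RCLike.star_def, Complex.mul_conj,
      ← Complex.ofReal_mul, Complex.ofReal_re]
  have hw : ∑ i, Complex.normSq (V s i) = 1 := by
    have := hentry fun _ => 1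
    simpa [h2] using this.symm
  have hle : l i₀ ≤ a := by
    rw [ha, hV, hentry]
    calc l i₀ = ∑ i, Complex.normSq (V s i) * l i₀ := by rw [← Finset.sum_mul, hw, one_mul]
      _ ≤ _ := Finset.sum_le_sum fun i hi =>
        mul_le_mul_of_nonneg_left (hi₀ i hi) (Complex.normSq_nonneg _)
  have hZa : Real.exp (-a) ≤ ∑ i, Real.exp (-l i) :=
    (Real.exp_le_exp.mpr (neg_le_neg hle)).trans
      (Finset.single_le_sum (f := fun i => Real.exp (-l i))
        (fun i _ => (Real.exp_pos _).le) (Finset.mem_univ i₀))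
  -- `x ≤ e^x` at `x = l i - a - c`, times `e^{-l i}`, removes the eigenvalue from the right side.
  have hterm (i : n) : (l i - a - c) * Real.exp (-l i) ≤ Real.exp (-a) * Real.exp (-c) := by
    have h3 : l i - a - c ≤ Real.exp (l i - a - c) := by linarith [Real.add_one_le_exp (l i - a - c)]
    calc _ ≤ Real.exp (l i - a - c) * Real.exp (-l i) :=
          mul_le_mul_of_nonneg_right h3 (Real.exp_pos _).le
      _ = _ := by rw [← Real.exp_add, ← Real.exp_add]; ring_nf
  have hsum : ∑ i, (l i - a - c) * Real.exp (-l i) ≤ Real.exp (-a) := by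
    calc _ ≤ ∑ _i : n, Real.exp (-a) * Real.exp (-c) := Finset.sum_le_sum fun i _ => hterm i
      _ = Fintype.card n * Real.exp (-c) * Real.exp (-a) := by
        rw [Finset.sum_const, nsmul_eq_mul, Finset.card_univ]; ring
      _ ≤ 1 * Real.exp (-a) := by
        refine mul_le_mul_of_nonneg_right ?_ (Real.exp_pos _).le
        rw [Real.exp_neg, ← div_eq_mul_inv, div_le_one (Real.exp_pos _)]
        exact hc
      _ = _ := one_mul _
  have hsplit : ∑ i, (l i - a - c) * Real.exp (-l i) =
      ∑ i, l i * Real.exp (-l i) - (a + c) * ∑ i, Real.exp (-l i) := by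
    rw [Finset.mul_sum, ← Finset.sum_sub_distrib]
    exact Finset.sum_congr rfl fun i _ => by ring
  rw [hAE, hZ]
  linarith

end Spectral

/-! ### Quadratic fermion operators -/

section Fock

open Matrix

variable {ι : Type*} [Fintype ι] [DecidableEq ι]

/-- The occupation number of the mode `i` in the configuration `S`. -/
def occ (i : ι) (S : Finset ι) : ℝ := if i ∈ S then 1 else 0

theorem modeNumber_eq_diagonal (i : ι) :
    modeNumber i = diagonal fun S : Finset ι => (occ i S : ℂ) := by
  ext A B
  rw [modeNumber, mul_apply, Finset.sum_eq_single (A.erase i)]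
  · rw [create_apply, annihilate_apply, diagonal_apply]
    by_cases hi : i ∈ A
    · by_cases h : A = B
      · subst h
        simp [hi, occ, wedgeSign_mul_self]
      · have : ¬(i ∉ A.erase i ∧ B = insert i (A.erase i)) := fun hh =>
          h (by rw [hh.2, Finset.insert_erase hi])
        rw [if_neg this, mul_zero, if_neg h]
    · have : ¬(i ∉ A.erase i ∧ A = insert i (A.erase i)) := fun hh =>
        hi (by rw [hh.2]; exact Finset.mem_insert_self _ _)
      rw [if_neg this, zero_mul]
      simp [occ, hi]
  · intro C _ hC
    rw [create_apply, if_neg, zero_mul]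
    rintro ⟨h1, rfl⟩
    simp [h1] at hC
  · simp

theorem posSemidef_one_sub_modeNumber (i : ι) : (1 - modeNumber i : FockOp ι).PosSemidef := by
  rw [modeNumber_eq_diagonal, ← diagonal_one, diagonal_sub]
  refine PosSemidef.diagonal fun S => ?_
  by_cases h : i ∈ S <;> simp [occ, h]

/-- Up to the sign of `r`, this is `|r| (c_i ± c_j)^* (c_i ± c_j)`. -/
theorem posSemidef_hop_add_modeNumber (r : ℝ) (i j : ι) :
    ((r : ℂ) • (create i * annihilate j + create j * annihilate i) +
      ((|r| : ℝ) : ℂ) • (modeNumber i + modeNumber j)).PosSemidef := by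
  have hc (k : ι) : (annihilate k)ᴴ = create k := conjTranspose_conjTranspose _
  rcases le_total 0 r with hr | hr
  · have h := (posSemidef_conjTranspose_mul_self (annihilate i + annihilate j)).smul
      (show (0 : ℂ) ≤ (r : ℂ) by exact_mod_cast hr)
    convert h using 1
    rw [abs_of_nonneg hr, ← smul_add, conjTranspose_add, hc, hc, modeNumber, modeNumber]
    congr 1
    noncomm_ring
  · have h := (posSemidef_conjTranspose_mul_self (annihilate i - annihilate j)).smul
      (show (0 : ℂ) ≤ ((-r : ℝ) : ℂ) by exact_mod_cast neg_nonneg.mpr hr)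
    convert h using 1
    rw [abs_of_nonpos hr, conjTranspose_sub, hc, hc, modeNumber, modeNumber]
    simp only [sub_mul, mul_sub, smul_add, smul_sub, Complex.ofReal_neg, neg_smul]
    abel

theorem posSemidef_hop_add_two (r : ℝ) (i j : ι) :
    ((r : ℂ) • (create i * annihilate j + create j * annihilate i) +
      ((2 * |r| : ℝ) : ℂ) • (1 : FockOp ι)).PosSemidef := by
  have hr : (0 : ℂ) ≤ ((|r| : ℝ) : ℂ) := by exact_mod_cast abs_nonneg r
  convert ((posSemidef_hop_add_modeNumber r i j).add
    ((posSemidef_one_sub_modeNumber i).smul hr)).add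
    ((posSemidef_one_sub_modeNumber j).smul hr) using 1
  push_cast
  module

end Fock

/-! ### Bounds on the hopping and field terms -/

open Matrix

section Operators

variable {d L : ℕ} [NeZero L]

/-- The number of bonds is at most `d |Λ_L|`: every bond is `{x, x + e_i}` for some `x` and `i`. -/
theorem card_edgeFinset_bondGraph_le [Fintype (bondGraph d L).edgeSet] :
    (bondGraph d L).edgeFinset.card ≤ d * Fintype.card (Torus d L) := by
  classical
  have hsub : (bondGraph d L).edgeFinset ⊆ Finset.univ.image
      fun p : Fin d × Torus d L => s(p.2, p.2 + Pi.single p.1 1) := by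
    intro b
    induction b using Sym2.ind with
    | _ x y =>
      rw [SimpleGraph.mem_edgeFinset, SimpleGraph.mem_edgeSet, bondGraph, SimpleGraph.fromRel_adj]
      rintro ⟨-, ⟨i, rfl⟩ | ⟨i, rfl⟩⟩
      · exact Finset.mem_image.mpr ⟨(i, x), Finset.mem_univ _, rfl⟩
      · exact Finset.mem_image.mpr ⟨(i, y), Finset.mem_univ _, Sym2.eq_swap⟩
  calc _ ≤ _ := Finset.card_le_card hsub
    _ ≤ _ := Finset.card_image_le
    _ = _ := by simp

/-- The constant is `2 |r|` for each of the two spins. -/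
theorem posSemidef_bondHop_add (r : ℝ) (x y : Torus d L) :
    ((r : ℂ) • bondHop x y + ((4 * |r| : ℝ) : ℂ) • (1 : FockOp (Mode d L))).PosSemidef := by
  convert (posSemidef_hop_add_two r (x, (0 : Fin 2)) (y, 0)).add
    (posSemidef_hop_add_two r (x, (1 : Fin 2)) (y, 1)) using 1
  rw [bondHop, Fin.sum_univ_two]
  push_cast
  module

theorem posSemidef_smul_hopping_add (t s : ℝ) (hs : |s| = 1) :
    ((s : ℂ) • hopping d L t +
      ((4 * |t| * d * Fintype.card (Torus d L) : ℝ) : ℂ) • (1 : FockOp (Mode d L))).PosSemidef := by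
  classical
  rw [hopping]
  set E := (bondGraph d L).edgeFinset with hE
  have hb (b : Sym2 (Torus d L)) : (((-(s * t) : ℝ) : ℂ) • Sym2.lift ⟨bondHop, bondHop_comm⟩ b +
      ((4 * |t| : ℝ) : ℂ) • (1 : FockOp (Mode d L))).PosSemidef := by
    induction b using Sym2.ind with
    | _ x y =>
      have h := posSemidef_bondHop_add (-(s * t)) x y
      rwa [abs_neg, abs_mul, hs, one_mul] at h
  have hcard : (E.card : ℝ) ≤ d * Fintype.card (Torus d L) := by
    exact_mod_cast card_edgeFinset_bondGraph_le (d := d) (L := L)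
  -- The bounds of the single bonds add up to `4 |t| |E|`; this is the slack up to `4 |t| d |Λ|`.
  have hrest : (0 : ℂ) ≤
      ((4 * |t| * (d * Fintype.card (Torus d L) - E.card) : ℝ) : ℂ) := by
    exact_mod_cast mul_nonneg (by positivity) (sub_nonneg.mpr hcard)
  convert (posSemidef_sum E fun b _ => hb b).add (PosSemidef.one.smul hrest) using 1
  rw [Finset.sum_add_distrib, ← Finset.smul_sum, Finset.sum_const, ← Nat.cast_smul_eq_nsmul ℂ]
  push_cast
  module

/-- The staggering `η_x` as a real number. -/
def realStagger (x : Torus d L) : ℝ := (-1) ^ (∑ i, (x i).val)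

omit [NeZero L] in
theorem ofReal_realStagger (x : Torus d L) : (realStagger x : ℂ) = stagger x := by
  simp [realStagger, stagger]

omit [NeZero L] in
theorem abs_realStagger (x : Torus d L) : |realStagger x| = 1 := by
  simp [realStagger]

theorem staggeredMagnetisation_eq_diagonal : staggeredMagnetisation d L =
    diagonal fun S => ((∑ x, realStagger x * ((occ (x, 0) S - occ (x, 1) S) / 2) : ℝ) : ℂ) := by
  ext A B
  simp only [staggeredMagnetisation, spinZ, nUp, nDown, modeNumber_eq_diagonal, diagonal_sub,
    ← diagonal_smul, Matrix.sum_apply, ← ofReal_realStagger]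
  by_cases h : A = B
  · subst h
    simp only [diagonal_apply_eq, Pi.smul_apply, smul_eq_mul]
    push_cast
    exact Finset.sum_congr rfl fun x _ => by ring
  · simp [h]

theorem occ_nonneg {ι : Type*} [DecidableEq ι] (i : ι) (S : Finset ι) : 0 ≤ occ i S := by
  unfold occ; split_ifs <;> norm_num

theorem occ_le_one {ι : Type*} [DecidableEq ι] (i : ι) (S : Finset ι) : occ i S ≤ 1 := by
  unfold occ; split_ifs <;> norm_num

theorem posSemidef_smul_staggeredMagnetisation_add (r h₀ : ℝ) (hr : |r| ≤ h₀) :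
    ((r : ℂ) • staggeredMagnetisation d L +
      ((h₀ * Fintype.card (Torus d L) : ℝ) : ℂ) • (1 : FockOp (Mode d L))).PosSemidef := by
  rw [staggeredMagnetisation_eq_diagonal, ← diagonal_smul, ← diagonal_one, ← diagonal_smul,
    diagonal_add]
  refine PosSemidef.diagonal fun S => ?_
  have hM : |∑ x : Torus d L, realStagger x * ((occ (x, 0) S - occ (x, 1) S) / 2)| ≤
      Fintype.card (Torus d L) := by
    refine (Finset.abs_sum_le_sum_abs _ _).trans ?_
    rw [← Finset.card_univ, ← nsmul_one]
    refine Finset.sum_le_card_nsmul _ _ _ fun x _ => ?_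
    rw [abs_mul, abs_realStagger, one_mul, abs_le]
    have h1 := occ_nonneg (x, (0 : Fin 2)) S
    have h2 := occ_nonneg (x, (1 : Fin 2)) S
    have h3 := occ_le_one (x, (0 : Fin 2)) S
    have h4 := occ_le_one (x, (1 : Fin 2)) S
    constructor <;> linarith
  have h5 : |r * ∑ x : Torus d L, realStagger x * ((occ (x, 0) S - occ (x, 1) S) / 2)| ≤
      h₀ * Fintype.card (Torus d L) := by
    rw [abs_mul]
    exact mul_le_mul hr hM (abs_nonneg _) ((abs_nonneg r).trans hr)
  have h6 := (abs_le.mp h5).1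
  simp only [Pi.smul_apply, smul_eq_mul, mul_one, Pi.zero_apply]
  exact_mod_cast (by linarith)

/-- `H(h) - U D` is bounded, above (`s = -1`) and below (`s = 1`), by a constant times the
volume, independent of `U`. -/
theorem posSemidef_smul_free_add (t U h h₀ s : ℝ) (hh : |h| ≤ h₀) (hs : |s| = 1) :
    ((s : ℂ) • (hamiltonian d L t U h - (U : ℂ) • doubleOccupancy d L) +
      (((4 * |t| * d + h₀) * Fintype.card (Torus d L) : ℝ) : ℂ) •
        (1 : FockOp (Mode d L))).PosSemidef := by
  convert (posSemidef_smul_hopping_add (d := d) (L := L) t s hs).add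
    (posSemidef_smul_staggeredMagnetisation_add (d := d) (L := L) (-(s * h)) h₀
      (by rwa [abs_neg, abs_mul, hs, one_mul])) using 1
  rw [hamiltonian]
  push_cast
  module

/-! ### Diagonal charge observables -/

/-- The number of doubly occupied sites of a configuration. -/
def doubleOcc (S : Finset (Mode d L)) : ℝ := ∑ x : Torus d L, occ (x, 0) S * occ (x, 1) S

theorem nUp_mul_nDown_eq_diagonal (x : Torus d L) :
    nUp x * nDown x = diagonal fun S => ((occ (x, 0) S * occ (x, 1) S : ℝ) : ℂ) := by
  simp [nUp, nDown, modeNumber_eq_diagonal]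

theorem doubleOccupancy_eq_diagonal :
    doubleOccupancy d L = diagonal fun S => (doubleOcc S : ℂ) := by
  ext A B
  simp only [doubleOccupancy, nUp_mul_nDown_eq_diagonal, Matrix.sum_apply, doubleOcc]
  by_cases h : A = B
  · subst h; simp
  · simp [h]

/-- The charge `n_x - 1` of a configuration at the site `x`. -/
def charge (x : Torus d L) (S : Finset (Mode d L)) : ℝ := occ (x, 0) S + occ (x, 1) S - 1

theorem siteNumber_sub_one_eq_diagonal (x : Torus d L) :
    siteNumber x - 1 = diagonal fun S => (charge x S : ℂ) := by
  simp only [siteNumber, nUp, nDown, modeNumber_eq_diagonal, diagonal_add, ← diagonal_one,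
    diagonal_sub]
  congr 1
  funext S
  simp [charge]

theorem defect_eq_diagonal (x : Torus d L) :
    defect x = diagonal fun S => ((charge x S ^ 2 : ℝ) : ℂ) := by
  rw [defect, siteNumber_sub_one_eq_diagonal, diagonal_pow]
  congr 1
  funext S
  simp

theorem staggeredCharge_eq_diagonal :
    staggeredCharge d L = diagonal fun S => ((∑ x, realStagger x * charge x S : ℝ) : ℂ) := by
  ext A B
  simp only [staggeredCharge, siteNumber_sub_one_eq_diagonal, ← diagonal_smul, Matrix.sum_apply,
    ← ofReal_realStagger]
  by_cases h : A = B
  · subst h; simp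
  · simp [h]

theorem staggeredCharge_sq_eq_diagonal :
    staggeredCharge d L ^ 2 =
      diagonal fun S => (((∑ x, realStagger x * charge x S) ^ 2 : ℝ) : ℂ) := by
  rw [staggeredCharge_eq_diagonal, diagonal_pow]
  congr 1
  funext S
  simp

omit [NeZero L] in
theorem charge_sq (x : Torus d L) (S : Finset (Mode d L)) :
    charge x S ^ 2 = 2 * (occ (x, 0) S * occ (x, 1) S) - charge x S := by
  unfold charge occ
  split_ifs <;> norm_num

omit [NeZero L] in
theorem abs_charge (x : Torus d L) (S : Finset (Mode d L)) : |charge x S| = charge x S ^ 2 := by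
  unfold charge occ
  split_ifs <;> norm_num

theorem sum_charge_halfFilled (S : HalfFilled d L) : ∑ x, charge x S.1 = 0 := by
  have h : ∑ x : Torus d L, (occ (x, 0) S.1 + occ (x, 1) S.1) = Fintype.card (Torus d L) := by
    have h1 : ∑ p : Mode d L, occ p S.1 = S.1.card := by simp [occ]
    rw [S.2] at h1
    rw [← h1, Fintype.sum_prod_type]
    exact Finset.sum_congr rfl fun x _ => by rw [Fin.sum_univ_two]
  simp only [charge, Finset.sum_sub_distrib, h]
  simp

/-- At half filling there are as many empty as doubly occupied sites. -/
theorem sum_charge_sq_halfFilled (S : HalfFilled d L) :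
    ∑ x, charge x S.1 ^ 2 = 2 * doubleOcc S.1 := by
  simp only [charge_sq, Finset.sum_sub_distrib, sum_charge_halfFilled, sub_zero, doubleOcc,
    Finset.mul_sum]

/-- Since `n_x - 1 ∈ {-1, 0, 1}`, the staggered charge is bounded by the number of defects. -/
theorem abs_staggered_sum_charge_le (S : HalfFilled d L) :
    |∑ x, realStagger x * charge x S.1| ≤ 2 * doubleOcc S.1 := by
  rw [← sum_charge_sq_halfFilled]
  refine (Finset.abs_sum_le_sum_abs _ _).trans_eq (Finset.sum_congr rfl fun x _ => ?_)
  rw [abs_mul, abs_realStagger, one_mul, abs_charge]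

/-- The Cauchy-Schwarz inequality over the sites. -/
theorem staggered_sum_charge_sq_le (S : HalfFilled d L) :
    (∑ x, realStagger x * charge x S.1) ^ 2 ≤
      Fintype.card (Torus d L) * (2 * doubleOcc S.1) := by
  rw [← sum_charge_sq_halfFilled]
  refine sq_sum_le_card_mul_sum_sq.trans_eq ?_
  rw [Finset.card_univ]
  congr 1
  refine Finset.sum_congr rfl fun x _ => ?_
  rw [mul_pow, ← sq_abs (realStagger x), abs_realStagger, one_pow, one_mul]

/-- The half-filled configuration with one spin-up electron on every site. -/
def polarized : HalfFilled d L :=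
  ⟨Finset.univ.map ⟨fun x => (x, 0), Prod.mk_left_injective 0⟩, by simp⟩

theorem doubleOcc_polarized : doubleOcc (polarized (d := d) (L := L)).1 = 0 :=
  Finset.sum_eq_zero fun x _ => by simp [occ, polarized]

theorem card_halfFilled_le :
    (Fintype.card (HalfFilled d L) : ℝ) ≤ Real.exp (2 * Fintype.card (Torus d L)) := by
  have h1 : Fintype.card (HalfFilled d L) ≤ 2 ^ (2 * Fintype.card (Torus d L)) := by
    refine (Fintype.card_subtype_le _).trans_eq ?_
    rw [Fintype.card_finset, Fintype.card_prod, Fintype.card_fin, mul_comm]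
  have h2 : (2 : ℝ) ≤ Real.exp 1 := by linarith [Real.add_one_le_exp 1]
  calc (Fintype.card (HalfFilled d L) : ℝ) ≤ 2 ^ (2 * Fintype.card (Torus d L)) := by
        exact_mod_cast h1
    _ ≤ Real.exp 1 ^ (2 * Fintype.card (Torus d L)) := by gcongr
    _ = _ := by rw [← Real.exp_nat_mul]; push_cast; ring_nf

theorem toHalfFilled_diagonal (f : Finset (Mode d L) → ℂ) :
    toHalfFilled (diagonal f) = diagonal fun S : HalfFilled d L => f S.1 :=
  submatrix_diagonal _ _ Subtype.val_injective

/-! ### The Gibbs state as a probability on configurations -/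

theorem isHermitian_hamiltonian (t U h : ℝ) : (hamiltonian d L t U h).IsHermitian := by
  have h1 := (posSemidef_smul_free_add (d := d) (L := L) t U h |h| 1 le_rfl abs_one).isHermitian
  have h2 : ((U : ℂ) • doubleOccupancy d L -
      (((4 * |t| * d + |h|) * Fintype.card (Torus d L) : ℝ) : ℂ) •
        (1 : FockOp (Mode d L))).IsHermitian := by
    rw [doubleOccupancy_eq_diagonal, ← diagonal_smul, ← diagonal_one, ← diagonal_smul,
      diagonal_sub]
    refine isHermitian_diagonal_of_self_adjoint _ (funext fun S => ?_)
    simp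
  convert h1.add h2 using 1
  push_cast
  module

theorem isHermitian_beta_hamiltonian (t U β h : ℝ) :
    ((β : ℂ) • toHalfFilled (hamiltonian d L t U h)).IsHermitian := by
  have := (isHermitian_hamiltonian (d := d) (L := L) t U h).submatrix
    (Subtype.val : HalfFilled d L → _)
  exact this.smul (by simp [IsSelfAdjoint])

theorem posDef_boltzmann (t U β h : ℝ) : (boltzmann d L t U β h).PosDef := by
  rw [boltzmann, neg_smul]
  exact posDef_exp_neg (isHermitian_beta_hamiltonian t U β h)

theorem boltzmann_apply_self (t U β h : ℝ) (S : HalfFilled d L) :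
    boltzmann d L t U β h S S = ((boltzmann d L t U β h S S).re : ℂ) :=
  Complex.eq_re_of_ofReal_le (r := 0)
    (by simpa using (posDef_boltzmann t U β h).posSemidef.diag_nonneg)

/-- The Gibbs probability `⟨e_S, e^{-βH} e_S⟩ / Z` of the configuration `S`. -/
def gibbsWeight (t U β h : ℝ) (S : HalfFilled d L) : ℝ :=
  (boltzmann d L t U β h S S).re / (partitionFunction d L t U β h).re

theorem partitionFunction_eq_sum (t U β h : ℝ) : partitionFunction d L t U β h =
    ((∑ S : HalfFilled d L, (boltzmann d L t U β h S S).re : ℝ) : ℂ) := by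
  rw [partitionFunction, trace, Complex.ofReal_sum]
  exact Finset.sum_congr rfl fun S _ => boltzmann_apply_self t U β h S

theorem partitionFunction_re_pos (t U β h : ℝ) : 0 < (partitionFunction d L t U β h).re := by
  have : Nonempty (HalfFilled d L) := ⟨polarized⟩
  exact (Complex.pos_iff.mp (posDef_boltzmann t U β h).trace_pos).1

theorem gibbsWeight_nonneg (t U β h : ℝ) (S : HalfFilled d L) : 0 ≤ gibbsWeight t U β h S :=
  div_nonneg (Complex.nonneg_iff.mp (posDef_boltzmann t U β h).posSemidef.diag_nonneg).1
    (partitionFunction_re_pos t U β h).le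

/-- Observables diagonal in the occupation-number basis have the classical expectation with
respect to `gibbsWeight`. -/
theorem gibbs_diagonal (t U β h : ℝ) (f : Finset (Mode d L) → ℝ) :
    gibbs d L t U β h (diagonal fun S => (f S : ℂ)) =
      ((∑ S : HalfFilled d L, f S.1 * gibbsWeight t U β h S : ℝ) : ℂ) := by
  have hZ : partitionFunction d L t U β h = ((partitionFunction d L t U β h).re : ℂ) := by
    rw [partitionFunction_eq_sum, Complex.ofReal_re]
  rw [gibbs, toHalfFilled_diagonal, trace, Complex.ofReal_sum, hZ, Finset.sum_div]
  refine Finset.sum_congr rfl fun S _ => ?_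
  rw [diag_apply, diagonal_mul, boltzmann_apply_self, gibbsWeight]
  push_cast
  ring

/-! ### Suppression of double occupancy -/

/-- The expected number of doubly occupied sites, from the variational principle with the
polarized trial configuration, which has no doubly occupied site. -/
theorem sum_doubleOcc_mul_gibbsWeight_le (t U β h h₀ : ℝ) (hU : 0 < U) (hβ : 0 < β)
    (hh : |h| ≤ h₀) :
    ∑ S : HalfFilled d L, doubleOcc S.1 * gibbsWeight t U β h S ≤
      Fintype.card (Torus d L) * ((2 * (4 * |t| * d + h₀) + 3 / β) / U) := by
  set N : ℝ := (Fintype.card (Torus d L) : ℝ) with hN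
  set k : ℝ := 4 * |t| * d + h₀ with hk
  set H := toHalfFilled (hamiltonian d L t U h) with hH
  set B := boltzmann d L t U β h with hB
  set Z := (partitionFunction d L t U β h).re with hZ
  have hN1 : 1 ≤ N := by
    rw [hN]; exact_mod_cast Fintype.card_pos
  have hZpos : 0 < Z := partitionFunction_re_pos t U β h
  set X := ∑ S : HalfFilled d L, doubleOcc S.1 * gibbsWeight t U β h S with hX
  have hD : toHalfFilled (doubleOccupancy d L) =
      diagonal fun S : HalfFilled d L => (doubleOcc S.1 : ℂ) := by
    rw [doubleOccupancy_eq_diagonal, toHalfFilled_diagonal]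
  have hfree (s : ℝ) (hs : |s| = 1) : ((s : ℂ) • (H - (U : ℂ) • diagonal fun S : HalfFilled d L =>
      (doubleOcc S.1 : ℂ)) + ((k * N : ℝ) : ℂ) • 1).PosSemidef := by
    have h1 := (posSemidef_smul_free_add (d := d) (L := L) t U h h₀ s hh hs).submatrix
      (Subtype.val : HalfFilled d L → _)
    rw [← hD]
    convert h1 using 1
    rw [← submatrix_one (Subtype.val : HalfFilled d L → _) Subtype.val_injective]
    rfl
  have hDB : ((diagonal fun S : HalfFilled d L => (doubleOcc S.1 : ℂ)) * B).trace.re = X * Z := by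
    rw [trace, Complex.re_sum, hX, Finset.sum_mul]
    refine Finset.sum_congr rfl fun S _ => ?_
    rw [diag_apply, diagonal_mul, Complex.re_ofReal_mul, gibbsWeight, mul_assoc,
      div_mul_cancel₀ _ hZpos.ne']
  -- Energy from below: `H ≥ U D - k |Λ|`, traced against the positive matrix `B`.
  have hlower : 0 ≤ (H * B).trace.re - U * (X * Z) + k * N * Z := by
    have h1 := (Complex.nonneg_iff.mp
      (trace_mul_nonneg (hfree 1 abs_one) (posDef_boltzmann t U β h).posSemidef)).1
    rw [← hB, Complex.ofReal_one, one_smul, add_mul, sub_mul, smul_mul, smul_mul, one_mul,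
      trace_add, trace_sub, trace_smul, trace_smul, smul_eq_mul, smul_eq_mul, Complex.add_re,
      Complex.sub_re, Complex.re_ofReal_mul, Complex.re_ofReal_mul, hDB] at h1
    exact h1
  have htrial : (H polarized polarized).re ≤ k * N := by
    have h1 := (Complex.nonneg_iff.mp
      ((hfree (-1) (by norm_num)).diag_nonneg (i := polarized))).1
    simp [doubleOcc_polarized] at h1
    linarith
  -- Energy from above: `ω(H) ≤ k |Λ| + 3 |Λ| / β`, where the entropy is at most `2 |Λ| + 1 ≤ 3 |Λ|`.
  have hupper : β * (H * B).trace.re ≤ (β * (k * N) + 3 * N) * Z := by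
    have h1 := re_trace_mul_exp_neg_le (isHermitian_beta_hamiltonian (d := d) (L := L) t U β h)
      polarized (2 * N) card_halfFilled_le
    rw [← neg_smul] at h1
    change (((β : ℂ) • H) * B).trace.re ≤
      ((((β : ℂ) • H) polarized polarized).re + 2 * N + 1) * Z at h1
    rw [smul_mul, trace_smul, Matrix.smul_apply, smul_eq_mul, smul_eq_mul, Complex.re_ofReal_mul,
      Complex.re_ofReal_mul] at h1
    refine h1.trans (mul_le_mul_of_nonneg_right ?_ hZpos.le)
    have := mul_le_mul_of_nonneg_left htrial hβ.le
    linarith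
  have h2 : (U * X) * Z ≤ (N * (2 * k + 3 / β)) * Z := by
    have h3 : (H * B).trace.re ≤ (k * N + 3 * N / β) * Z := by
      rw [← mul_le_mul_iff_right₀ hβ]
      refine hupper.trans_eq ?_
      field_simp
    have h4 : N * (2 * k + 3 / β) * Z = (k * N + 3 * N / β) * Z + k * N * Z := by ring
    rw [h4]
    linarith
  have h5 := le_of_mul_le_mul_right h2 hZpos
  rw [mul_div_assoc', le_div_iff₀ hU]
  linarith

/-! ### Expectations of the charge observables -/

theorem sum_gibbs_defect (t U β h : ℝ) :
    ∑ x : Torus d L, gibbs d L t U β h (defect x) =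
      ((2 * ∑ S : HalfFilled d L, doubleOcc S.1 * gibbsWeight t U β h S : ℝ) : ℂ) := by
  simp only [defect_eq_diagonal]
  rw [Finset.sum_congr rfl fun x _ => gibbs_diagonal t U β h fun S => charge x S ^ 2,
    ← Complex.ofReal_sum, Finset.sum_comm, Finset.mul_sum]
  congr 1
  refine Finset.sum_congr rfl fun S _ => ?_
  rw [← Finset.sum_mul, sum_charge_sq_halfFilled, mul_assoc]

theorem sum_gibbs_nUp_mul_nDown (t U β h : ℝ) :
    ∑ x : Torus d L, gibbs d L t U β h (nUp x * nDown x) =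
      ((∑ S : HalfFilled d L, doubleOcc S.1 * gibbsWeight t U β h S : ℝ) : ℂ) := by
  simp only [nUp_mul_nDown_eq_diagonal]
  rw [Finset.sum_congr rfl fun x _ =>
      gibbs_diagonal t U β h fun S => occ (x, 0) S * occ (x, 1) S,
    ← Complex.ofReal_sum, Finset.sum_comm]
  congr 1
  refine Finset.sum_congr rfl fun S _ => ?_
  rw [← Finset.sum_mul, doubleOcc]

theorem norm_gibbs_staggeredCharge_le (t U β h : ℝ) :
    ‖gibbs d L t U β h (staggeredCharge d L)‖ ≤
      2 * ∑ S : HalfFilled d L, doubleOcc S.1 * gibbsWeight t U β h S := by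
  rw [staggeredCharge_eq_diagonal, gibbs_diagonal t U β h fun S => ∑ x, realStagger x * charge x S,
    Complex.norm_real, Real.norm_eq_abs, Finset.mul_sum]
  refine (Finset.abs_sum_le_sum_abs _ _).trans (Finset.sum_le_sum fun S _ => ?_)
  rw [abs_mul, abs_of_nonneg (gibbsWeight_nonneg t U β h S), ← mul_assoc]
  exact mul_le_mul_of_nonneg_right (abs_staggered_sum_charge_le S) (gibbsWeight_nonneg t U β h S)

theorem gibbs_staggeredCharge_sq_le (t U β h : ℝ) :
    gibbs d L t U β h (staggeredCharge d L ^ 2) ≤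
      ((Fintype.card (Torus d L) *
        (2 * ∑ S : HalfFilled d L, doubleOcc S.1 * gibbsWeight t U β h S) : ℝ) : ℂ) := by
  rw [staggeredCharge_sq_eq_diagonal,
    gibbs_diagonal t U β h fun S => (∑ x, realStagger x * charge x S) ^ 2]
  refine Complex.real_le_real.mpr ?_
  rw [Finset.mul_sum, Finset.mul_sum]
  refine Finset.sum_le_sum fun S _ => ?_
  rw [← mul_assoc 2, ← mul_assoc]
  exact mul_le_mul_of_nonneg_right (staggered_sum_charge_sq_le S) (gibbsWeight_nonneg t U β h S)

end Operators

/-! ### The error function -/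

/-- The error function `2 (2 (4 |t| d + h₀) + 3 / β) / U`, with an absolute value that makes it
nonnegative for unphysical arguments as well. -/
def chargeError (d : ℕ) (t h₀ U β : ℝ) : ℝ := 2 * |(2 * (4 * |t| * d + h₀) + 3 / β) / U|

theorem tendsto_iSup_chargeError (d : ℕ) {t h₀ ℓ₀ : ℝ} (hh₀ : 0 < h₀) (hℓ₀ : 0 < ℓ₀) :
    Filter.Tendsto
      (fun U : ℝ => ⨆ (β : ℝ) (_ : 0 < β) (_ : ℓ₀ ≤ β * exchange t U),
        ENNReal.ofReal (chargeError d t h₀ U β))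
      Filter.atTop (nhds 0) := by
  have hlim : Filter.Tendsto (fun U : ℝ =>
      ENNReal.ofReal (2 * ((2 * (4 * |t| * d + h₀) + 3 * (4 * t ^ 2 / U / ℓ₀)) / U)))
      Filter.atTop (nhds 0) := by
    rw [← ENNReal.ofReal_zero]
    refine ENNReal.tendsto_ofReal ?_
    have h1 : Filter.Tendsto (fun U : ℝ => 2 * (4 * |t| * d + h₀) + 3 * (4 * t ^ 2 / U / ℓ₀))
        Filter.atTop (nhds (2 * (4 * |t| * d + h₀) + 3 * (0 / ℓ₀))) :=
      (((Filter.tendsto_id.const_div_atTop (4 * t ^ 2)).div_const ℓ₀).const_mul 3).const_add _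
    simpa using (h1.div_atTop Filter.tendsto_id).const_mul 2
  refine tendsto_of_tendsto_of_tendsto_of_le_of_le' tendsto_const_nhds hlim
    (Filter.Eventually.of_forall fun _ => zero_le) ?_
  filter_upwards [Filter.eventually_gt_atTop 0] with U hU
  refine iSup_le fun β => iSup_le fun hβ => iSup_le fun hℓ => ENNReal.ofReal_le_ofReal ?_
  -- The hypothesis `ℓ₀ ≤ β J₀(U)` bounds the temperature by `J₀(U) / ℓ₀`.
  have hinv : 1 / β ≤ 4 * t ^ 2 / U / ℓ₀ := by
    rw [div_le_div_iff₀ hβ hℓ₀, one_mul, mul_comm]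
    exact hℓ
  have h3 : 3 / β = 3 * (1 / β) := by ring
  rw [chargeError, abs_of_nonneg (by positivity), h3]
  gcongr

end Hubbard
end

/-- Inequalities `z ≤ (r : ℂ)` between complex numbers mean that `z` is real and `z ≤ r`. -/
theorem mainTheorem3 (d : ℕ) (hd : 1 ≤ d) (t : ℝ) (ht : t ≠ 0) (h₀ : ℝ) (hh₀ : 0 < h₀) :
    ∃ ε : ℝ → ℝ → ℝ, (∀ U β : ℝ, 0 ≤ ε U β) ∧
      ∀ ℓ₀ : ℝ, 0 < ℓ₀ →
        (∃ U₀ : ℝ, 0 < U₀ ∧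
          ∀ U : ℝ, U₀ ≤ U → ∀ β : ℝ, 0 < β → ℓ₀ ≤ β * Hubbard.exchange t U →
          ∀ (L : ℕ) [NeZero L], Even L → ∀ h : ℝ, |h| ≤ h₀ →
            (1 / (Fintype.card (Hubbard.Torus d L) : ℂ) *
                ∑ x : Hubbard.Torus d L,
                  Hubbard.gibbs d L t U β h (Hubbard.defect x) ≤ (ε U β : ℂ)) ∧
            (1 / (Fintype.card (Hubbard.Torus d L) : ℂ) *
                ∑ x : Hubbard.Torus d L,
                  Hubbard.gibbs d L t U β h (Hubbard.nUp x * Hubbard.nDown x)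
                ≤ ((1 / 2 * ε U β : ℝ) : ℂ)) ∧
            ‖1 / (Fintype.card (Hubbard.Torus d L) : ℂ) *
                Hubbard.gibbs d L t U β h (Hubbard.staggeredCharge d L)‖ ≤ ε U β ∧
            (1 / (Fintype.card (Hubbard.Torus d L) : ℂ) ^ 2 *
                Hubbard.gibbs d L t U β h (Hubbard.staggeredCharge d L ^ 2)
                ≤ (ε U β : ℂ))) ∧
        Filter.Tendsto
          (fun U : ℝ => ⨆ (β : ℝ) (_ : 0 < β) (_ : ℓ₀ ≤ β * Hubbard.exchange t U),
            ENNReal.ofReal (ε U β))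
          Filter.atTop (nhds 0) := by
  refine ⟨Hubbard.chargeError d t h₀, fun U β => by unfold Hubbard.chargeError; positivity,
    fun ℓ₀ hℓ₀ => ⟨⟨1, one_pos, ?_⟩, Hubbard.tendsto_iSup_chargeError d hh₀ hℓ₀⟩⟩
  intro U hU₁ β hβ _ L _ _ h hh
  have hU : 0 < U := one_pos.trans_le hU₁
  have hN : (0 : ℝ) < Fintype.card (Hubbard.Torus d L) := by exact_mod_cast Fintype.card_pos
  have hD := Hubbard.sum_doubleOcc_mul_gibbsWeight_le (d := d) (L := L) t U β h h₀ hU hβ hh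
  set X := ∑ S : Hubbard.HalfFilled d L, Hubbard.doubleOcc S.1 * Hubbard.gibbsWeight t U β h S
    with hX
  set N : ℝ := (Fintype.card (Hubbard.Torus d L) : ℝ) with hNdef
  have hε : 2 * X ≤ N * Hubbard.chargeError d t h₀ U β := by
    rw [Hubbard.chargeError, abs_of_nonneg (by positivity)]
    linarith
  have hcast : (Fintype.card (Hubbard.Torus d L) : ℂ) = (N : ℂ) := by simp [hNdef]
  rw [hcast]
  refine ⟨?_, ?_, ?_, ?_⟩
  · rw [Hubbard.sum_gibbs_defect, ← hX, ← Complex.ofReal_one, ← Complex.ofReal_div,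
      ← Complex.ofReal_mul]
    refine Complex.real_le_real.mpr ?_
    rw [one_div_mul_eq_div, div_le_iff₀' hN]
    exact hε
  · rw [Hubbard.sum_gibbs_nUp_mul_nDown, ← hX, ← Complex.ofReal_one, ← Complex.ofReal_div,
      ← Complex.ofReal_mul]
    refine Complex.real_le_real.mpr ?_
    rw [one_div_mul_eq_div, div_le_iff₀' hN]
    linarith
  · rw [norm_mul, norm_div, norm_one, Complex.norm_real, Real.norm_of_nonneg hN.le,
      one_div_mul_eq_div, div_le_iff₀' hN]
    exact (Hubbard.norm_gibbs_staggeredCharge_le t U β h).trans hε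
  · have hN2 : (0 : ℂ) ≤ 1 / (N : ℂ) ^ 2 := by
      have : (0 : ℝ) ≤ 1 / N ^ 2 := by positivity
      exact_mod_cast this
    refine (mul_le_mul_of_nonneg_left (Hubbard.gibbs_staggeredCharge_sq_le t U β h) hN2).trans ?_
    rw [← hX, ← hNdef, ← Complex.ofReal_one, ← Complex.ofReal_pow, ← Complex.ofReal_div,
      ← Complex.ofReal_mul]
    refine Complex.real_le_real.mpr ?_
    rw [one_div_mul_eq_div, div_le_iff₀' (by positivity), sq, mul_assoc]
    exact mul_le_mul_of_nonneg_left hε hN.le
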